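/- Let $K$ be a complete normed field, that is, a field complete with respect to a multiplicative absolute value $|\cdot|$ (for example $K=\mathbb{C}$, or the formal Laurent series $k((q))$ over a field $k$ with the $q$-adic absolute value). Let $b,q\in K$ with $|q|<1$. The $n$-th convergent of a continued fraction $c_0+\cfrac{a_1}{c_1+\cfrac{a_2}{c_2+\cdots}}$ is $P_n/Q_n$, where $P_{-1}=1$, $P_0=c_0$, $Q_{-1}=0$, $Q_0=1$, $P_n=c_nP_{n-1}+a_nP_{n-2}$, $Q_n=c_nQ_{n-1}+a_nQ_{n-2}$. The continued fraction equals $v$ if $Q_n\neq 0$ for all large $n$ and $P_n/Q_n\to v$. Write $(q)_n=\prod_{k=1}^n(1-q^k)$. (i) If $1+bq^{2m}\ne 0$ for all $m\ge 1$, then $$1+\cfrac{bq}{1+q+\cfrac{bq^2}{1+q^2+\cfrac{bq^3}{1+q^3+\ddots}}}=\prod_{m=1}^{\infty}\frac{1+bq^{2m-1}}{1+bq^{2m}},$$ where the product converges unconditionally. (ii) For every $b\in K$, the numerators $P_n$ and denominators $Q_n$ of the continued fraction in (i) converge, and $$\lim_{n\to\infty}P_n=\sum_{i,j\ge 0}\frac{b^jq^{(i^2+i)/2+ij+j^2}}{(q)_i(q)_j}=\prod_{m=1}^{\infty}(1+bq^{2m-1})(1+q^m),$$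 $$\lim_{n\to\infty}Q_n=\sum_{i,j\ge 0}\frac{b^jq^{(i^2+i)/2+ij+j^2+j}}{(q)_i(q)_j}=\prod_{m=1}^{\infty}(1+bq^{2m})(1+q^m),$$ where the sums and products converge unconditionally. (iii) If $1+bq^{4m-1}\ne 0$ for all $m\ge 1$, then $$1+\cfrac{bq}{1+q^2+\cfrac{bq^3}{1+q^4+\cfrac{bq^5}{1+q^6+\ddots}}}=\prod_{m=1}^{\infty}\frac{1+bq^{4m-3}}{1+bq^{4m-1}},$$ where the product converges unconditionally. For $q\neq0$ this is the continued fraction of (i) with $q$ replaced by $q^2$ and $b$ by $bq^{-1}$. -/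

import Mathlib

open Filter Topology

/-- The infinite continued fraction `h + a 0 / (c 0 + a 1 / (c 1 + a 2 / (c 2 + ⋯)))`. -/
def infiniteContFract {K : Type*} (h : K) (a c : ℕ → K) : GenContFract K :=
  ⟨h, Stream'.Seq.ofStream fun n => ⟨a n, c n⟩⟩

/-- Ramanujan's continued fraction
`R(a,b) = 1 + b q / (1 + a q + b q² / (1 + a q² + b q³ / (1 + a q³ + ⋯)))`. -/
def ramanujanR {K : Type*} [Field K] (q a b : K) : GenContFract K :=
  infiniteContFract 1 (fun n => b * q ^ (n + 1)) (fun n => 1 + a * q ^ (n + 1))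

/-- The continued fraction `1 + b q / (1 + q² + b q³ / (1 + q⁴ + b q⁵ / (1 + q⁶ + ⋯)))`. -/
def oddContFract {K : Type*} [Field K] (q b : K) : GenContFract K :=
  infiniteContFract 1 (fun n => b * q ^ (2 * n + 1)) (fun n => 1 + q ^ (2 * n + 2))

/-- A continued fraction converges to `v` if its convergents `Pₙ / Qₙ` are defined (that is,
`Qₙ ≠ 0`) for all large `n` and tend to `v`. Here `Pₙ` and `Qₙ` are the canonical numerators and
denominators `g.nums n` and `g.dens n`, and `g.convs n = g.nums n / g.dens n`. -/
def ContFractConvergesTo {K : Type*} [NormedField K] (g : GenContFract K) (v : K) : Prop :=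
  (∀ᶠ n in atTop, g.dens n ≠ 0) ∧ Tendsto g.convs atTop (𝓝 v)

/-- `(q)ₙ = (1 - q)(1 - q²)⋯(1 - qⁿ)`. -/
def qFactorial {K : Type*} [Field K] (q : K) (n : ℕ) : K :=
  ∏ k ∈ Finset.range n, (1 - q ^ (k + 1))

/-!
Write `H(x, y) = ∑ xⁱ yʲ q^{(i²+i)/2 + ij + j²} / ((q)ᵢ (q)ⱼ)`, summed over `i, j ≥ 0`. The proof
rests on two `q`-difference equations. The factor `1 - qⁱ` (resp. `1 - qʲ`) cancels the last factor
of `(q)ᵢ` (resp. `(q)ⱼ`), and a shift of the index then gives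

* `H(x, y) = H(xq, y) + xq H(xq, yq)` (`lebesgueSeries_eq_add_fst`),
* `H(x, y) = H(x, yq) + yq H(xq, yq²)` (`lebesgueSeries_eq_add_snd`).

*Products.* Together they give `H(1, y) = (1 + yq) H(1, yq²)`, and the first alone gives
`H(x, 0) = (1 + xq) H(xq, 0)`. As `H` is continuous and `H(0, 0) = 1`, iteration yields
`H(1, y) = ∏ (1 + yq^{2m-1})(1 + q^m)` (`hasProd_lebesgueSeries`), which covers both products in
the theorem through `y = b` and `y = bq`.

*Continuants.* The sequence `uₙ = H(qⁿ, bqⁿ⁺¹)` satisfies `uₙ = (1 + qⁿ⁺¹) uₙ₊₁ + bqⁿ⁺² uₙ₊₂`,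
which is the recurrence adjoint to `pₙ = (1 + qⁿ) pₙ₋₁ + bqⁿ pₙ₋₂`. Hence
`pₙ₊₁ uₙ₊₁ + bqⁿ⁺² uₙ₊₂ pₙ` does not depend on `n`. Solutions `p` are bounded and `uₙ → 1`, so `pₙ`
converges to this constant (`tendsto_of_ramanujan_recurrence`). It is `H(1, bq)` for the
denominators and `H(1, bq) + bq H(q, bq²) = H(1, b)` for the numerators.

The value of the continued fraction is the quotient of the two products: the common factor
`∏ (1 + q^m)` is nonzero and cancels.
-/

/-! ### The double series -/

section

variable {K : Type*} [NormedField K]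

lemma one_sub_pow_succ_ne_zero {q : K} (hq : ‖q‖ < 1) (n : ℕ) : 1 - q ^ (n + 1) ≠ 0 := by
  intro h
  have h1 : ‖q‖ ^ (n + 1) = 1 := by rw [← norm_pow, ← sub_eq_zero.1 h, norm_one]
  exact (pow_lt_one₀ (norm_nonneg q) hq n.succ_ne_zero).ne h1

lemma one_add_pow_succ_ne_zero {q : K} (hq : ‖q‖ < 1) (n : ℕ) : 1 + q ^ (n + 1) ≠ 0 := by
  intro h
  have h1 : ‖q‖ ^ (n + 1) = 1 := by
    rw [← norm_pow, eq_neg_of_add_eq_zero_right h, norm_neg, norm_one]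
  exact (pow_lt_one₀ (norm_nonneg q) hq n.succ_ne_zero).ne h1

lemma qFactorial_succ (q : K) (n : ℕ) :
    qFactorial q (n + 1) = qFactorial q n * (1 - q ^ (n + 1)) :=
  Finset.prod_range_succ _ _

lemma qFactorial_ne_zero {q : K} (hq : ‖q‖ < 1) (n : ℕ) : qFactorial q n ≠ 0 :=
  Finset.prod_ne_zero_iff.2 fun k _ => one_sub_pow_succ_ne_zero hq k

lemma sq_add_self_div_two_succ (i : ℕ) :
    ((i + 1) ^ 2 + (i + 1)) / 2 = (i ^ 2 + i) / 2 + (i + 1) := by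
  rw [show (i + 1) ^ 2 + (i + 1) = (i ^ 2 + i) + (i + 1) * 2 by ring,
    Nat.add_mul_div_right _ _ two_pos]

/-- The term `xⁱ yʲ q^{(i²+i)/2 + ij + j²} / ((q)ᵢ (q)ⱼ)`. -/
def lebesgueTerm (q x y : K) (p : ℕ × ℕ) : K :=
  x ^ p.1 * y ^ p.2 * q ^ ((p.1 ^ 2 + p.1) / 2 + p.1 * p.2 + p.2 ^ 2) /
    (qFactorial q p.1 * qFactorial q p.2)

/-- The two-variable series `H(x, y) = ∑ xⁱ yʲ q^{(i²+i)/2 + ij + j²} / ((q)ᵢ (q)ⱼ)`. -/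
noncomputable def lebesgueSeries (q x y : K) : K :=
  ∑' p, lebesgueTerm q x y p

/-- Ratio test for one-variable series with super-linearly growing exponents of `q`. -/
lemma summable_mul_pow_div_norm_qFactorial {q : K} (hq : ‖q‖ < 1) (M : ℝ) {e : ℕ → ℕ}
    (he : ∀ n, e n + n ≤ e (n + 1)) :
    Summable fun n => M ^ n * ‖q‖ ^ e n / ‖qFactorial q n‖ := by
  have hr : Tendsto (fun n => |M| * ‖q‖ ^ n / ‖1 - q ^ (n + 1)‖) atTop (𝓝 0) := by
    have h1 : Tendsto (fun n : ℕ => ‖1 - q ^ (n + 1)‖) atTop (𝓝 1) := by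
      have := ((tendsto_pow_atTop_nhds_zero_of_norm_lt_one hq).comp
        (tendsto_add_atTop_nat 1)).const_sub 1
      simpa using this.norm
    have h2 := ((tendsto_pow_atTop_nhds_zero_of_lt_one (norm_nonneg q) hq).const_mul |M|).div h1
      one_ne_zero
    rwa [mul_zero, zero_div] at h2
  refine summable_of_ratio_norm_eventually_le (r := 1 / 2) (by norm_num) ?_
  filter_upwards [hr.eventually_le_const (show (0 : ℝ) < 1 / 2 by norm_num)] with n hn
  have h0 : 0 < ‖qFactorial q n‖ := norm_pos_iff.2 (qFactorial_ne_zero hq n)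
  have h1 : 0 < ‖1 - q ^ (n + 1)‖ := norm_pos_iff.2 (one_sub_pow_succ_ne_zero hq n)
  have h2 : ‖q‖ ^ e (n + 1) ≤ ‖q‖ ^ (e n + n) :=
    pow_le_pow_of_le_one (norm_nonneg q) hq.le (he n)
  simp only [norm_div, norm_mul, norm_pow, Real.norm_eq_abs, abs_norm]
  calc |M| ^ (n + 1) * ‖q‖ ^ e (n + 1) / ‖qFactorial q (n + 1)‖
      ≤ |M| ^ (n + 1) * ‖q‖ ^ (e n + n) / ‖qFactorial q (n + 1)‖ := by gcongr
    _ = (|M| * ‖q‖ ^ n / ‖1 - q ^ (n + 1)‖) * (|M| ^ n * ‖q‖ ^ e n / ‖qFactorial q n‖) := by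
        rw [qFactorial_succ, norm_mul, pow_succ, pow_add]
        field_simp
    _ ≤ 1 / 2 * (|M| ^ n * ‖q‖ ^ e n / ‖qFactorial q n‖) := by gcongr

/-- A summable majorant, uniform on bounded sets of `x` and `y`. -/
lemma exists_summable_norm_lebesgueTerm_le {q : K} (hq : ‖q‖ < 1) (M : ℝ) :
    ∃ B : ℕ × ℕ → ℝ, Summable B ∧
      ∀ x y : K, ‖x‖ ≤ M → ‖y‖ ≤ M → ∀ p, ‖lebesgueTerm q x y p‖ ≤ B p := by
  rcases lt_or_ge M 0 with hM | hM
  · exact ⟨0, summable_zero, fun x _ hx => absurd (hx.trans_lt hM) (norm_nonneg x).not_gt⟩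
  have h1 := summable_mul_pow_div_norm_qFactorial hq M (e := fun i => (i ^ 2 + i) / 2)
    (fun n => by rw [sq_add_self_div_two_succ]; omega)
  have h2 := summable_mul_pow_div_norm_qFactorial hq M (e := fun j => j ^ 2)
    (fun n => by nlinarith)
  refine ⟨_, h1.mul_of_nonneg h2 (fun n => by positivity) (fun n => by positivity), ?_⟩
  rintro x y hx hy ⟨i, j⟩
  have h3 : ‖q‖ ^ ((i ^ 2 + i) / 2 + i * j + j ^ 2) ≤ ‖q‖ ^ ((i ^ 2 + i) / 2 + j ^ 2) :=
    pow_le_pow_of_le_one (norm_nonneg q) hq.le (by omega)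
  simp only [lebesgueTerm, norm_div, norm_mul, norm_pow]
  calc ‖x‖ ^ i * ‖y‖ ^ j * ‖q‖ ^ ((i ^ 2 + i) / 2 + i * j + j ^ 2) /
        (‖qFactorial q i‖ * ‖qFactorial q j‖)
      ≤ M ^ i * M ^ j * ‖q‖ ^ ((i ^ 2 + i) / 2 + j ^ 2) /
        (‖qFactorial q i‖ * ‖qFactorial q j‖) := by gcongr
    _ = _ := by rw [pow_add]; ring

lemma hasSum_lebesgueSeries [CompleteSpace K] {q : K} (hq : ‖q‖ < 1) (x y : K) :
    HasSum (lebesgueTerm q x y) (lebesgueSeries q x y) := by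
  obtain ⟨B, hB, h⟩ := exists_summable_norm_lebesgueTerm_le hq (max ‖x‖ ‖y‖)
  exact (hB.of_norm_bounded (h x y (le_max_left _ _) (le_max_right _ _))).hasSum

lemma tendsto_lebesgueSeries [CompleteSpace K] {q : K} (hq : ‖q‖ < 1) {x y : ℕ → K} {x₀ y₀ : K}
    (hx : Tendsto x atTop (𝓝 x₀)) (hy : Tendsto y atTop (𝓝 y₀)) :
    Tendsto (fun n => lebesgueSeries q (x n) (y n)) atTop (𝓝 (lebesgueSeries q x₀ y₀)) := by
  obtain ⟨B, hB, h⟩ := exists_summable_norm_lebesgueTerm_le hq (max (‖x₀‖ + 1) (‖y₀‖ + 1))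
  refine tendsto_tsum_of_dominated_convergence hB (fun p => ?_) ?_
  · exact (((hx.pow _).mul (hy.pow _)).mul_const _).div_const _
  · filter_upwards [hx.norm.eventually_le_const (lt_add_one ‖x₀‖),
      hy.norm.eventually_le_const (lt_add_one ‖y₀‖)] with n h1 h2
    exact h _ _ (h1.trans (le_max_left _ _)) (h2.trans (le_max_right _ _))

lemma lebesgueSeries_zero_zero (q : K) : lebesgueSeries q 0 0 = 1 := by
  rw [lebesgueSeries, tsum_eq_single (0, 0)]
  · simp [lebesgueTerm, qFactorial]
  · rintro ⟨i, j⟩ h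
    rcases Nat.eq_zero_or_pos i with rfl | hi
    · have hj : j ≠ 0 := fun hj => h (by rw [hj])
      simp [lebesgueTerm, hj]
    · simp [lebesgueTerm, hi.ne']

/-! ### Difference equations and the product -/

lemma lebesgueSeries_eq_add_fst [CompleteSpace K] {q : K} (hq : ‖q‖ < 1) (x y : K) :
    lebesgueSeries q x y =
      lebesgueSeries q (x * q) y + x * q * lebesgueSeries q (x * q) (y * q) := by
  have h1 := (hasSum_lebesgueSeries hq x y).sub (hasSum_lebesgueSeries hq (x * q) y)
  have h2 := (hasSum_lebesgueSeries hq (x * q) (y * q)).mul_left (x * q)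
  have hg : Function.Injective fun p : ℕ × ℕ => (p.1 + 1, p.2) := by
    rintro ⟨i, j⟩ ⟨k, l⟩ h
    simpa using h
  rw [← hg.hasSum_iff] at h1
  · refine sub_eq_iff_eq_add'.1 (h1.unique (h2.congr_fun ?_))
    rintro ⟨i, j⟩
    have := qFactorial_ne_zero hq i
    have := qFactorial_ne_zero hq j
    have := one_sub_pow_succ_ne_zero hq i
    simp only [Function.comp, lebesgueTerm, qFactorial_succ, sq_add_self_div_two_succ]
    field_simp
    ring
  · rintro ⟨i, j⟩ h
    cases i with
    | zero => simp [lebesgueTerm]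
    | succ i => exact absurd ⟨(i, j), rfl⟩ h

lemma lebesgueSeries_eq_add_snd [CompleteSpace K] {q : K} (hq : ‖q‖ < 1) (x y : K) :
    lebesgueSeries q x y =
      lebesgueSeries q x (y * q) + y * q * lebesgueSeries q (x * q) (y * q ^ 2) := by
  have h1 := (hasSum_lebesgueSeries hq x y).sub (hasSum_lebesgueSeries hq x (y * q))
  have h2 := (hasSum_lebesgueSeries hq (x * q) (y * q ^ 2)).mul_left (y * q)
  have hg : Function.Injective fun p : ℕ × ℕ => (p.1, p.2 + 1) := by
    rintro ⟨i, j⟩ ⟨k, l⟩ h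
    simpa using h
  rw [← hg.hasSum_iff] at h1
  · refine sub_eq_iff_eq_add'.1 (h1.unique (h2.congr_fun ?_))
    rintro ⟨i, j⟩
    have := qFactorial_ne_zero hq i
    have := qFactorial_ne_zero hq j
    have := one_sub_pow_succ_ne_zero hq j
    simp only [Function.comp, lebesgueTerm, qFactorial_succ]
    field_simp
    ring
  · rintro ⟨i, j⟩ h
    cases j with
    | zero => simp [lebesgueTerm]
    | succ j => exact absurd ⟨(i, j), rfl⟩ h

lemma lebesgueSeries_one_eq_mul [CompleteSpace K] {q : K} (hq : ‖q‖ < 1) (y : K) :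
    lebesgueSeries q 1 y = (1 + y * q) * lebesgueSeries q 1 (y * q ^ 2) := by
  have h1 := lebesgueSeries_eq_add_snd hq 1 y
  have h2 := lebesgueSeries_eq_add_snd hq 1 (y * q)
  have h3 := lebesgueSeries_eq_add_fst hq 1 (y * q ^ 2)
  rw [show y * q * q = y * q ^ 2 by ring, show y * q * q ^ 2 = y * q ^ 2 * q by ring] at h2
  linear_combination h1 + h2 - y * q * h3

lemma lebesgueSeries_zero_right_eq_mul [CompleteSpace K] {q : K} (hq : ‖q‖ < 1) (x : K) :
    lebesgueSeries q x 0 = (1 + x * q) * lebesgueSeries q (x * q) 0 := by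
  have h := lebesgueSeries_eq_add_fst hq x 0
  rw [zero_mul] at h
  linear_combination h

lemma summable_norm_mul_pow {q : K} (hq : ‖q‖ < 1) (c : K) {e : ℕ → ℕ} (he : ∀ m, m ≤ e m) :
    Summable fun m => ‖c * q ^ e m‖ := by
  refine ((summable_geometric_of_lt_one (norm_nonneg q) hq).mul_left ‖c‖).of_nonneg_of_le
    (fun _ => norm_nonneg _) fun m => ?_
  rw [norm_mul, norm_pow]
  exact mul_le_mul_of_nonneg_left (pow_le_pow_of_le_one (norm_nonneg q) hq.le (he m))
    (norm_nonneg c)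

lemma multipliable_one_add_mul_pow [CompleteSpace K] {q : K} (hq : ‖q‖ < 1) (c : K) {e : ℕ → ℕ}
    (he : ∀ m, m ≤ e m) : Multipliable fun m => 1 + c * q ^ e m :=
  multipliable_one_add_of_summable (summable_norm_mul_pow hq c he)

lemma tprod_one_add_mul_pow_ne_zero [CompleteSpace K] {q : K} (hq : ‖q‖ < 1) (c : K) {e : ℕ → ℕ}
    (he : ∀ m, m ≤ e m) (h : ∀ m, 1 + c * q ^ e m ≠ 0) : ∏' m, (1 + c * q ^ e m) ≠ 0 :=
  tprod_one_add_ne_zero_of_summable h (summable_norm_mul_pow hq c he)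

/-- Iterating a first-order recurrence `u m = f m * u (m + 1)`. -/
lemma HasProd.eq_of_eq_mul_succ {f u : ℕ → K} {a l : K} (hf : HasProd f a)
    (hu : Tendsto u atTop (𝓝 l)) (h : ∀ m, u m = f m * u (m + 1)) : u 0 = a * l := by
  have h1 : ∀ N, u 0 = (∏ m ∈ Finset.range N, f m) * u N := by
    intro N
    induction N with
    | zero => simp
    | succ N ih => rw [ih, Finset.prod_range_succ, h N, mul_assoc]
  have h2 : Tendsto (fun _ : ℕ => u 0) atTop (𝓝 (a * l)) :=
    (hf.tendsto_prod_nat.mul hu).congr fun N => (h1 N).symm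
  exact tendsto_nhds_unique tendsto_const_nhds h2

lemma tendsto_mul_pow_zero {q : K} (hq : ‖q‖ < 1) (c : K) {e : ℕ → ℕ} (he : ∀ m, m ≤ e m) :
    Tendsto (fun m => c * q ^ e m) atTop (𝓝 0) :=
  tendsto_zero_iff_norm_tendsto_zero.2 (summable_norm_mul_pow hq c he).tendsto_atTop_zero

lemma lebesgueSeries_one_zero [CompleteSpace K] {q : K} (hq : ‖q‖ < 1) :
    lebesgueSeries q 1 0 = ∏' m : ℕ, (1 + q ^ (m + 1)) := by
  have h := (multipliable_one_add_mul_pow hq 1 (e := fun m => m + 1)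
    Nat.le_succ).hasProd.eq_of_eq_mul_succ
    (u := fun m => lebesgueSeries q (q ^ m) 0)
    (tendsto_lebesgueSeries hq (tendsto_pow_atTop_nhds_zero_of_norm_lt_one hq)
      tendsto_const_nhds)
    fun m => by rw [one_mul, pow_succ]; exact lebesgueSeries_zero_right_eq_mul hq _
  simpa [lebesgueSeries_zero_zero] using h

lemma lebesgueSeries_one_eq_tprod [CompleteSpace K] {q : K} (hq : ‖q‖ < 1) (y : K) :
    lebesgueSeries q 1 y =
      (∏' m : ℕ, (1 + y * q ^ (2 * m + 1))) * ∏' m : ℕ, (1 + q ^ (m + 1)) := by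
  have h := (multipliable_one_add_mul_pow hq y (e := fun m => 2 * m + 1)
    (fun m => by omega)).hasProd.eq_of_eq_mul_succ
    (u := fun m => lebesgueSeries q 1 (y * q ^ (2 * m)))
    (tendsto_lebesgueSeries hq tendsto_const_nhds
      (tendsto_mul_pow_zero hq y (e := fun m => 2 * m) (fun m => by omega)))
    fun m => by
      have := lebesgueSeries_one_eq_mul hq (y * q ^ (2 * m))
      rw [mul_assoc, mul_assoc, ← pow_succ, ← pow_add] at this
      exact this
  rw [← lebesgueSeries_one_zero hq]
  simpa using h

lemma hasProd_lebesgueSeries [CompleteSpace K] {q : K} (hq : ‖q‖ < 1) (y : K) :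
    HasProd (fun m : ℕ => (1 + y * q ^ (2 * m + 1)) * (1 + q ^ (m + 1)))
      (lebesgueSeries q 1 y) := by
  rw [lebesgueSeries_one_eq_tprod hq]
  have h1 := multipliable_one_add_mul_pow hq y (e := fun m => 2 * m + 1) (fun m => by omega)
  have h2 := multipliable_one_add_mul_pow hq 1 (e := fun m => m + 1) Nat.le_succ
  simp only [one_mul] at h2
  exact h1.hasProd.mul h2.hasProd

/-! ### Limits of the continuants -/

/-- The sequence `uₙ = H(qⁿ, bqⁿ⁺¹)` solves the recurrence adjoint to that of the continuants. -/
lemma lebesgueSeries_adjoint_recurrence [CompleteSpace K] {q : K} (hq : ‖q‖ < 1) (b : K) (n : ℕ) :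
    lebesgueSeries q (q ^ n) (b * q ^ (n + 1)) =
      (1 + q ^ (n + 1)) * lebesgueSeries q (q ^ (n + 1)) (b * q ^ (n + 2)) +
        b * q ^ (n + 2) * lebesgueSeries q (q ^ (n + 2)) (b * q ^ (n + 3)) := by
  have h1 := lebesgueSeries_eq_add_fst hq (q ^ n) (b * q ^ (n + 1))
  have h2 := lebesgueSeries_eq_add_snd hq (q ^ (n + 1)) (b * q ^ (n + 1))
  simp only [mul_assoc, ← pow_succ, ← pow_add, add_assoc, Nat.reduceAdd] at h1 h2 ⊢
  linear_combination h1 + h2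

/-- The maximum of two consecutive norms grows at most by the factor `1 + (1 + ‖b‖) ‖q‖ⁿ` in each
step, and the product of these factors converges. -/
lemma exists_norm_le_of_ramanujan_recurrence {q : K} (hq : ‖q‖ < 1) (b : K) {p : ℕ → K}
    (hp : ∀ n, p (n + 2) = (1 + q ^ (n + 2)) * p (n + 1) + b * q ^ (n + 2) * p n) :
    ∃ M, ∀ n, ‖p n‖ ≤ M := by
  have hs : Summable fun n : ℕ => (1 + ‖b‖) * ‖q‖ ^ n :=
    (summable_geometric_of_lt_one (norm_nonneg q) hq).mul_left _
  have h0 : ∀ n : ℕ, 0 ≤ (1 + ‖b‖) * ‖q‖ ^ n := fun n => by positivity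
  have hm : ∀ n, max ‖p n‖ ‖p (n + 1)‖ ≤
      max ‖p 0‖ ‖p 1‖ * Real.exp (∑ k ∈ Finset.range n, (1 + ‖b‖) * ‖q‖ ^ k) := by
    intro n
    induction n with
    | zero => simp
    | succ n ih =>
      rw [Finset.sum_range_succ, Real.exp_add, ← mul_assoc]
      set m := max ‖p n‖ ‖p (n + 1)‖ with hmdef
      have hm0 : 0 ≤ m := (norm_nonneg _).trans (le_max_left _ _)
      have hq2 : ‖q‖ ^ (n + 2) ≤ ‖q‖ ^ n :=
        pow_le_pow_of_le_one (norm_nonneg q) hq.le (by omega)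
      have step : max ‖p (n + 1)‖ ‖p (n + 2)‖ ≤ m * (1 + (1 + ‖b‖) * ‖q‖ ^ n) := by
        refine max_le ?_ ?_
        · exact (le_max_right _ _).trans
            (le_mul_of_one_le_right hm0 (le_add_of_nonneg_right (h0 n)))
        · calc ‖p (n + 2)‖
              ≤ (1 + ‖q‖ ^ (n + 2)) * ‖p (n + 1)‖ + ‖b‖ * ‖q‖ ^ (n + 2) * ‖p n‖ := by
                rw [hp]
                refine (norm_add_le _ _).trans ?_
                simp only [norm_mul, norm_pow]
                gcongr
                refine (norm_add_le _ _).trans ?_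
                simp
            _ ≤ (1 + ‖q‖ ^ n) * m + ‖b‖ * ‖q‖ ^ n * m := by
                gcongr
                · exact le_max_right _ _
                · exact le_max_left _ _
            _ = m * (1 + (1 + ‖b‖) * ‖q‖ ^ n) := by ring
      refine step.trans (mul_le_mul ih ?_ (by positivity) (by positivity))
      rw [add_comm]
      exact Real.add_one_le_exp _
  refine ⟨_, fun n => (le_max_left _ _).trans ((hm n).trans (mul_le_mul_of_nonneg_left
    (Real.exp_le_exp.2 (hs.sum_le_tsum _ fun k _ => h0 k)) (by positivity)))⟩

/-- Every solution of the recurrence for the continuants converges, and its limit is the constant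
value, here taken at `n = 0`, of its pairing with the adjoint solution `H(qⁿ, bqⁿ⁺¹)`. -/
lemma tendsto_of_ramanujan_recurrence [CompleteSpace K] {q : K} (hq : ‖q‖ < 1) (b : K) {p : ℕ → K}
    (hp : ∀ n, p (n + 2) = (1 + q ^ (n + 2)) * p (n + 1) + b * q ^ (n + 2) * p n) :
    Tendsto p atTop (𝓝 (p 1 * lebesgueSeries q q (b * q ^ 2) +
      b * q ^ 2 * lebesgueSeries q (q ^ 2) (b * q ^ 3) * p 0)) := by
  obtain ⟨M, hM⟩ := exists_norm_le_of_ramanujan_recurrence hq b hp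
  set u : ℕ → K := fun n => lebesgueSeries q (q ^ n) (b * q ^ (n + 1)) with hu
  set c : K := p 1 * lebesgueSeries q q (b * q ^ 2) +
      b * q ^ 2 * lebesgueSeries q (q ^ 2) (b * q ^ 3) * p 0 with hc
  have hinv : ∀ n, p (n + 1) * u (n + 1) + b * q ^ (n + 2) * u (n + 2) * p n = c := by
    intro n
    induction n with
    | zero => simp [hu, hc]
    | succ n ih =>
      rw [← ih]
      have h := lebesgueSeries_adjoint_recurrence hq b (n + 1)
      change u (n + 1) = (1 + q ^ (n + 2)) * u (n + 2) + b * q ^ (n + 3) * u (n + 3) at h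
      change p (n + 2) * u (n + 2) + b * q ^ (n + 3) * u (n + 3) * p (n + 1) = _
      rw [h, hp]
      ring
  have hu1 : Tendsto u atTop (𝓝 1) := by
    rw [← lebesgueSeries_zero_zero q]
    exact tendsto_lebesgueSeries hq (tendsto_pow_atTop_nhds_zero_of_norm_lt_one hq)
      (tendsto_mul_pow_zero hq b (e := fun n => n + 1) Nat.le_succ)
  have hsmall : Tendsto (fun n => b * q ^ (n + 2) * u (n + 2) * p n) atTop (𝓝 0) := by
    have h1 : Tendsto (fun n => b * q ^ (n + 2) * u (n + 2)) atTop (𝓝 0) := by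
      simpa using (tendsto_mul_pow_zero hq b (e := fun n => n + 2) (fun n => by omega)).mul
        (hu1.comp (tendsto_add_atTop_nat 2))
    have h2 := h1.norm.mul_const M
    rw [norm_zero, zero_mul] at h2
    refine squeeze_zero_norm (fun n => ?_) h2
    rw [norm_mul (b * q ^ (n + 2) * u (n + 2))]
    exact mul_le_mul_of_nonneg_left (hM n) (norm_nonneg _)
  have hu2 : Tendsto (fun n => u (n + 1)) atTop (𝓝 1) := hu1.comp (tendsto_add_atTop_nat 1)
  have hlim := (hsmall.const_sub c).div hu2 one_ne_zero
  rw [sub_zero, div_one] at hlim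
  rw [← tendsto_add_atTop_iff_nat 1]
  refine hlim.congr' ?_
  filter_upwards [hu2.eventually_ne one_ne_zero] with n hn
  rw [Pi.div_apply, div_eq_iff hn, ← hinv n]
  ring

lemma ramanujanR_get? (q b : K) (n : ℕ) :
    (ramanujanR q 1 b).s.get? n = some ⟨b * q ^ (n + 1), 1 + 1 * q ^ (n + 1)⟩ := rfl

lemma tendsto_ramanujanR_nums [CompleteSpace K] {q : K} (hq : ‖q‖ < 1) (b : K) :
    Tendsto (ramanujanR q 1 b).nums atTop (𝓝 (lebesgueSeries q 1 b)) := by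
  convert tendsto_of_ramanujan_recurrence hq b (p := (ramanujanR q 1 b).nums) ?_ using 2
  · rw [GenContFract.first_num_eq (ramanujanR_get? q b 0), GenContFract.zeroth_num_eq_h]
    have h1 := lebesgueSeries_eq_add_snd hq 1 b
    have h2 := lebesgueSeries_adjoint_recurrence hq b 0
    simp only [ramanujanR, infiniteContFract, pow_zero, zero_add, pow_one, one_mul, mul_one]
      at h1 h2 ⊢
    linear_combination h1 + h2
  · intro n
    rw [GenContFract.nums_recurrence (ramanujanR_get? q b (n + 1)) rfl rfl, one_mul]

lemma tendsto_ramanujanR_dens [CompleteSpace K] {q : K} (hq : ‖q‖ < 1) (b : K) :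
    Tendsto (ramanujanR q 1 b).dens atTop (𝓝 (lebesgueSeries q 1 (b * q))) := by
  convert tendsto_of_ramanujan_recurrence hq b (p := (ramanujanR q 1 b).dens) ?_ using 2
  · rw [GenContFract.first_den_eq (ramanujanR_get? q b 0), GenContFract.zeroth_den_eq_one]
    have h2 := lebesgueSeries_adjoint_recurrence hq b 0
    simp only [pow_zero, zero_add, pow_one, one_mul, mul_one] at h2 ⊢
    linear_combination h2
  · intro n
    rw [GenContFract.dens_recurrence (ramanujanR_get? q b (n + 1)) rfl rfl, one_mul]

/-! ### Values of the continued fractions -/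

lemma ramanujanR_convergesTo [CompleteSpace K] {q : K} (hq : ‖q‖ < 1) (b : K)
    (hb : ∀ m : ℕ, 1 + b * q ^ (2 * m + 2) ≠ 0) :
    Multipliable (fun m : ℕ => (1 + b * q ^ (2 * m + 1)) / (1 + b * q ^ (2 * m + 2))) ∧
      ContFractConvergesTo (ramanujanR q 1 b)
        (∏' m : ℕ, (1 + b * q ^ (2 * m + 1)) / (1 + b * q ^ (2 * m + 2))) := by
  have hA := multipliable_one_add_mul_pow hq b (e := fun m => 2 * m + 1) (fun m => by omega)
  have hB := multipliable_one_add_mul_pow hq b (e := fun m => 2 * m + 2) (fun m => by omega)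
  have hB0 := tprod_one_add_mul_pow_ne_zero hq b (e := fun m => 2 * m + 2) (fun m => by omega) hb
  have hW0 : ∏' m : ℕ, (1 + q ^ (m + 1)) ≠ 0 := by
    simpa using tprod_one_add_mul_pow_ne_zero hq 1 (e := fun m => m + 1) Nat.le_succ
      (fun m => by simpa using one_add_pow_succ_ne_zero hq m)
  have hnum := lebesgueSeries_one_eq_tprod hq b
  have hden := lebesgueSeries_one_eq_tprod hq (b * q)
  simp only [mul_assoc b q, ← pow_succ', add_assoc, Nat.reduceAdd] at hden
  have hQ0 : lebesgueSeries q 1 (b * q) ≠ 0 := hden ▸ mul_ne_zero hB0 hW0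
  refine ⟨hA.div₀ hB hB0, (tendsto_ramanujanR_dens hq b).eventually_ne hQ0, ?_⟩
  rw [hA.tprod_div₀ hB hB0, ← mul_div_mul_right _ _ hW0, ← hnum, ← hden]
  exact ((tendsto_ramanujanR_nums hq b).div (tendsto_ramanujanR_dens hq b) hQ0).congr
    fun n => GenContFract.conv_eq_num_div_den.symm

lemma oddContFract_eq_ramanujanR {q : K} (hq : q ≠ 0) (b : K) :
    oddContFract q b = ramanujanR (q ^ 2) 1 (b / q) := by
  unfold oddContFract ramanujanR
  congr 1
  · funext n
    field_simp
    ring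
  · funext n
    ring

/-- For `q = 0` both continued fractions are `1 + 0 / (1 + 0 / (1 + ⋯))`. -/
lemma oddContFract_zero (b : K) : oddContFract 0 b = ramanujanR 0 1 b := by
  simp [oddContFract, ramanujanR]

lemma oddContFract_convergesTo [CompleteSpace K] {q : K} (hq : ‖q‖ < 1) (b : K)
    (hb : ∀ m : ℕ, 1 + b * q ^ (4 * m + 3) ≠ 0) :
    Multipliable (fun m : ℕ => (1 + b * q ^ (4 * m + 1)) / (1 + b * q ^ (4 * m + 3))) ∧
      ContFractConvergesTo (oddContFract q b)
        (∏' m : ℕ, (1 + b * q ^ (4 * m + 1)) / (1 + b * q ^ (4 * m + 3))) := by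
  rcases eq_or_ne q 0 with rfl | hq0
  · rw [oddContFract_zero]
    simpa using ramanujanR_convergesTo hq b (by simp)
  · have h1 : ∀ m : ℕ, b / q * (q ^ 2) ^ (2 * m + 1) = b * q ^ (4 * m + 1) := fun m => by
      field_simp
      ring
    have h2 : ∀ m : ℕ, b / q * (q ^ 2) ^ (2 * m + 2) = b * q ^ (4 * m + 3) := fun m => by
      field_simp
      ring
    have hq2 : ‖q ^ 2‖ < 1 := by
      rw [norm_pow]
      exact pow_lt_one₀ (norm_nonneg q) hq two_ne_zero
    have h := ramanujanR_convergesTo hq2 (b / q) (fun m => by rw [h2]; exact hb m)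
    simp only [h1, h2] at h
    rwa [oddContFract_eq_ramanujanR hq0]

end

theorem mainTheorem3 {K : Type*} [NormedField K] [CompleteSpace K] (q b : K) (hq : ‖q‖ < 1) :
    -- the continued fraction `R(1,b)` and its product
    ((∀ m : ℕ, 1 + b * q ^ (2 * m + 2) ≠ 0) →
      Multipliable (fun m : ℕ => (1 + b * q ^ (2 * m + 1)) / (1 + b * q ^ (2 * m + 2))) ∧
      ContFractConvergesTo (ramanujanR q 1 b)
        (∏' m : ℕ, (1 + b * q ^ (2 * m + 1)) / (1 + b * q ^ (2 * m + 2)))) ∧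
    -- the limit of its numerators, as a double series and as a product
    (∃ P : K, Tendsto (ramanujanR q 1 b).nums atTop (𝓝 P) ∧
      HasSum (fun p : ℕ × ℕ =>
        b ^ p.2 * q ^ ((p.1 ^ 2 + p.1) / 2 + p.1 * p.2 + p.2 ^ 2) /
          (qFactorial q p.1 * qFactorial q p.2)) P ∧
      HasProd (fun m : ℕ => (1 + b * q ^ (2 * m + 1)) * (1 + q ^ (m + 1))) P) ∧
    -- the limit of its denominators, as a double series and as a product
    (∃ Q : K, Tendsto (ramanujanR q 1 b).dens atTop (𝓝 Q) ∧
      HasSum (fun p : ℕ × ℕ =>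
        b ^ p.2 * q ^ ((p.1 ^ 2 + p.1) / 2 + p.1 * p.2 + p.2 ^ 2 + p.2) /
          (qFactorial q p.1 * qFactorial q p.2)) Q ∧
      HasProd (fun m : ℕ => (1 + b * q ^ (2 * m + 2)) * (1 + q ^ (m + 1))) Q) ∧
    -- the continued fraction obtained by `q ↦ q²`, `b ↦ b q⁻¹`
    ((∀ m : ℕ, 1 + b * q ^ (4 * m + 3) ≠ 0) →
      Multipliable (fun m : ℕ => (1 + b * q ^ (4 * m + 1)) / (1 + b * q ^ (4 * m + 3))) ∧
      ContFractConvergesTo (oddContFract q b)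
        (∏' m : ℕ, (1 + b * q ^ (4 * m + 1)) / (1 + b * q ^ (4 * m + 3)))) := by
  refine ⟨ramanujanR_convergesTo hq b,
    ⟨_, tendsto_ramanujanR_nums hq b, ?_, hasProd_lebesgueSeries hq b⟩,
    ⟨_, tendsto_ramanujanR_dens hq b, ?_, ?_⟩,
    oddContFract_convergesTo hq b⟩
  · refine (hasSum_lebesgueSeries hq 1 b).congr_fun fun p => ?_
    simp only [lebesgueTerm, one_pow, one_mul]
  · refine (hasSum_lebesgueSeries hq 1 (b * q)).congr_fun fun p => ?_
    simp only [lebesgueTerm]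
    ring
  · simpa only [mul_assoc b q, ← pow_succ', add_assoc, Nat.reduceAdd] using
      hasProd_lebesgueSeries hq (b * q)
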